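/- For $N \ge 1$ let $L_N \in \mathbb{R}^{N\times N}$ be the Laplacian matrix of the path graph on the nodes $1, 2, \dots, N$ (node $i$ adjacent to node $i+1$), and let $e_j$ denote the $j$-th standard basis vector. For a real symmetric matrix $A$ let $\lambda_{\min}(A)$ denote its smallest eigenvalue. A set $S$ of $k$ nodes is called an optimal set of $k$ ports (a set of $k$-centers) of the path on $N$ nodes if, for all sufficiently small $\epsilon > 0$, it maximizes $\lambda_{\min}\bigl(L_N + \epsilon \sum_{j \in S} e_j e_j^T\bigr)$ among all sets of $k$ nodes. Let $n$ be an odd positive integer. Then the path on $n$ nodes has exactly one optimal set of $1$ port, namely $\{p^*\}$ with $p^* = \frac{n+1}{2}$, and the path on $2n$ nodes has exactly one optimal set of $2$ ports, namely $\{p_1^*, p_2^*\}$ with $p_1^* = \frac{2n+2}{4} = \frac{n+1}{2}$ and $p_2^* = \frac{6n+2}{4} = \frac{3n+1}{2}$. Moreover, for every real $\epsilon$, $$\lambda_{\min}\bigl(L_n + \epsilon\, e_{p^*} e_{p^*}^T\bigr) = \lambda_{\min}\bigl(L_{2n} + \epsilon\,(e_{p_1^*} e_{p_1^*}^T + e_{p_2^*}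 e_{p_2^*}^T)\bigr);$$ in particular, the two smallest eigenvalues agree to second order in $\epsilon$. -/

import Mathlib

open Filter Topology

/-- The Laplacian `L` of `G` perturbed at the ports `S`: `L + ε ∑_{j ∈ S} e_j e_jᵀ`. -/
noncomputable def perturbedLaplacian {V : Type*} [Fintype V] [DecidableEq V]
    (G : SimpleGraph V) [DecidableRel G.Adj] (S : Finset V) (ε : ℝ) : Matrix V V ℝ :=
  G.lapMatrix ℝ +
    ε • ∑ j ∈ S, Matrix.vecMulVec (Pi.single j (1 : ℝ)) (Pi.single j (1 : ℝ))

/-- The smallest (real) eigenvalue of a square matrix. For a real symmetric matrix of positive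
size the spectrum is finite and non-empty, so the infimum is attained, see
`isLeast_lambdaMin`. -/
noncomputable def lambdaMin {V : Type*} [Fintype V] [DecidableEq V] (A : Matrix V V ℝ) : ℝ :=
  sInf (spectrum ℝ A)

theorem isLeast_lambdaMin {V : Type*} [Fintype V] [DecidableEq V] [Nonempty V]
    {A : Matrix V V ℝ} (hA : A.IsHermitian) : IsLeast (spectrum ℝ A) (lambdaMin A) := by
  have hs : spectrum ℝ A = Set.range hA.eigenvalues := hA.spectrum_real_eq_range_eigenvalues
  have hne : (spectrum ℝ A).Nonempty := by rw [hs]; exact Set.range_nonempty _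
  have hfin : (spectrum ℝ A).Finite := by rw [hs]; exact Set.finite_range _
  exact ⟨hne.csInf_mem hfin, fun _ hx => csInf_le hfin.bddBelow hx⟩

theorem isHermitian_perturbedLaplacian {V : Type*} [Fintype V] [DecidableEq V]
    (G : SimpleGraph V) [DecidableRel G.Adj] (S : Finset V) (ε : ℝ) :
    (perturbedLaplacian G S ε).IsHermitian := by
  ext i j
  have h : G.lapMatrix ℝ j i = G.lapMatrix ℝ i j := (G.isSymm_lapMatrix (R := ℝ)).apply i j
  simp [perturbedLaplacian, Matrix.sum_apply, Matrix.vecMulVec_apply, h, mul_comm]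

/-- `S` is an optimal set of `k` ports (a set of best `k` nodes, or `k`-centers) of `G`:
for all sufficiently small `ε > 0` it maximizes the smallest eigenvalue of the perturbed
Laplacian among all sets of `k` nodes. -/
def IsOptimalPorts {V : Type*} [Fintype V] [DecidableEq V]
    (G : SimpleGraph V) [DecidableRel G.Adj] (k : ℕ) (S : Finset V) : Prop :=
  S.card = k ∧ ∀ᶠ ε in 𝓝[>] (0 : ℝ), ∀ T : Finset V, T.card = k →
    lambdaMin (perturbedLaplacian G T ε) ≤ lambdaMin (perturbedLaplacian G S ε)

/-- The node `p* = (n + 1) / 2` of the path on `1, …, n`, where the node `p` is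
the element `p - 1` of `Fin n`. -/
def pathCenter (n : ℕ) (hn : Odd n) : Fin n :=
  ⟨(n + 1) / 2 - 1, by obtain ⟨m, rfl⟩ := hn; omega⟩

/-- The node `p₁* = (N + 2) / 4` of the path on `1, …, N`, for `N = 2 n`. -/
def leftCenter (n : ℕ) (hn : Odd n) : Fin (2 * n) :=
  ⟨(2 * n + 2) / 4 - 1, by obtain ⟨m, rfl⟩ := hn; omega⟩

/-- The node `p₂* = (3 N + 2) / 4` of the path on `1, …, N`, for `N = 2 n`. -/
def rightCenter (n : ℕ) (hn : Odd n) : Fin (2 * n) :=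
  ⟨(3 * (2 * n) + 2) / 4 - 1, by obtain ⟨m, rfl⟩ := hn; omega⟩

theorem pathCenter_spec (n : ℕ) (hn : Odd n) : 2 * ((pathCenter n hn : ℕ) + 1) = n + 1 := by
  obtain ⟨m, rfl⟩ := hn
  simp only [pathCenter]; omega

theorem leftCenter_spec (n : ℕ) (hn : Odd n) :
    4 * ((leftCenter n hn : ℕ) + 1) = 2 * n + 2 := by
  obtain ⟨m, rfl⟩ := hn
  simp only [leftCenter]; omega

theorem rightCenter_spec (n : ℕ) (hn : Odd n) :
    4 * ((rightCenter n hn : ℕ) + 1) = 3 * (2 * n) + 2 := by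
  obtain ⟨m, rfl⟩ := hn
  simp only [rightCenter]; omega

/-! By the Rayleigh principle everything is a comparison of quadratic forms. On a path of `2 * m +
1` nodes with its port in the middle, the ground state is a profile `U` of the distance to the port,
increasing along each arm, with eigenvalue `μ` (`exists_isProfile`). Completing squares along the
arms shows that the smallest eigenvalue is at least `μ` (`le_form_center`).

For any `k` ports on `k * (2 * m + 1)` nodes, the test function "`U` of the distance to the nearest
port" has Rayleigh quotient at most `μ` (`form_portMode_le`), so no port set beats `μ`. If a set
reaches `μ`, this test function is a minimizer and satisfies the eigenvalue equation at the first
node, which puts the first port at distance exactly `m` from that end (`isLeast_of_form`);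
reflection handles the last port. For `k = 1, 2` the two extreme ports are the whole set.

The equality of eigenvalues for every real `ε` is separate: cut the middle edge of the long path for
one inequality, reflect a test function across it for the other (`lambdaMin_center_eq`). -/

/-! ### Rayleigh characterization and the quadratic form of the path. -/

open Finset Matrix in
theorem le_lambdaMin_iff {V : Type*} [Fintype V] [DecidableEq V] [Nonempty V]
    {A : Matrix V V ℝ} (hA : A.IsHermitian) (c : ℝ) :
    c ≤ lambdaMin A ↔ ∀ x : V → ℝ, c * (x ⬝ᵥ x) ≤ x ⬝ᵥ (A *ᵥ x) := by
  constructor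
  · intro h x
    have hP : (A - algebraMap ℝ (Matrix V V ℝ) c).PosSemidef := by
      rw [posSemidef_iff_isHermitian_and_spectrum_nonneg]
      refine ⟨hA.sub ?_, ?_⟩
      · rw [algebraMap_eq_diagonal]
        exact isHermitian_diagonal _
      · rw [← spectrum.sub_singleton_eq]
        rintro _ ⟨a, ha, _, rfl, rfl⟩
        exact sub_nonneg.2 (h.trans ((isLeast_lambdaMin hA).2 ha))
    have := hP.dotProduct_mulVec_nonneg x
    rw [sub_mulVec, dotProduct_sub, Algebra.algebraMap_eq_smul_one, smul_mulVec, one_mulVec,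
      dotProduct_smul, smul_eq_mul, star_trivial] at this
    linarith
  · intro h
    have hmem := (isLeast_lambdaMin hA).1
    rw [hA.spectrum_real_eq_range_eigenvalues] at hmem
    obtain ⟨j, hj⟩ := hmem
    have hv := hA.mulVec_eigenvectorBasis j
    have hx := h (hA.eigenvectorBasis j).ofLp
    rw [hv, dotProduct_smul, smul_eq_mul, hj] at hx
    have hpos : 0 < (hA.eigenvectorBasis j).ofLp ⬝ᵥ (hA.eigenvectorBasis j).ofLp := by
      have h0 : (hA.eigenvectorBasis j).ofLp ≠ 0 := fun h0 =>
        hA.eigenvectorBasis.orthonormal.ne_zero j (by ext i; simp [h0])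
      have := dotProduct_star_self_pos_iff.2 h0
      rwa [star_trivial] at this
    exact le_of_mul_le_mul_right hx hpos

open Finset in
/-- The Dirichlet energy of `x` on the path on `0, …, N - 1`. -/
def pathEnergy (N : ℕ) (x : ℕ → ℝ) : ℝ := ∑ i ∈ range (N - 1), (x (i + 1) - x i) ^ 2

open Finset Matrix in
theorem dotProduct_lapMatrix_pathGraph (N : ℕ) [DecidableRel (SimpleGraph.pathGraph N).Adj]
    (x : ℕ → ℝ) :
    (fun i : Fin N => x i) ⬝ᵥ ((SimpleGraph.pathGraph N).lapMatrix ℝ *ᵥ fun i : Fin N => x i) =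
      pathEnergy N x := by
  rw [← toLinearMap₂'_apply', SimpleGraph.lapMatrix_toLinearMap₂']
  simp only [SimpleGraph.pathGraph_adj]
  have key : (∑ i ∈ range N, ∑ j ∈ range N, if i + 1 = j then (x i - x j) ^ 2 else 0) =
      pathEnergy N x := by
    obtain - | M := N
    · simp [pathEnergy]
    · simp only [Finset.sum_ite_eq, mem_range]
      rw [sum_range_succ, if_neg (by omega), add_zero, pathEnergy]
      refine sum_congr rfl fun i hi => ?_
      rw [if_pos (by simpa using hi)]
      ring
  have split (i j : ℕ) : (if i + 1 = j ∨ j + 1 = i then (x i - x j) ^ 2 else 0) =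
      (if i + 1 = j then (x i - x j) ^ 2 else 0) + if j + 1 = i then (x j - x i) ^ 2 else 0 := by
    split_ifs <;> first | omega | ring
  rw [Fin.sum_univ_eq_sum_range (fun i => ∑ j : Fin N,
    if i + 1 = (j : ℕ) ∨ (j : ℕ) + 1 = i then (x i - x j) ^ 2 else 0) N]
  simp_rw [fun i => Fin.sum_univ_eq_sum_range
    (fun j => if i + 1 = j ∨ j + 1 = i then (x i - x j) ^ 2 else 0) N, split, sum_add_distrib]
  rw [sum_comm (f := fun i j => if j + 1 = i then (x j - x i) ^ 2 else 0), key]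
  ring

open Finset Matrix in
-- Test vectors are functions on `ℕ`, so shifts and reflections need no `Fin` casts; values from `N`
-- on play no role.
theorem le_lambdaMin_pathGraph_iff {N : ℕ} (hN : 0 < N)
    [DecidableRel (SimpleGraph.pathGraph N).Adj] (S : Finset (Fin N)) (ε c : ℝ) :
    c ≤ lambdaMin (perturbedLaplacian (SimpleGraph.pathGraph N) S ε) ↔
      ∀ x : ℕ → ℝ, c * ∑ i ∈ range N, x i ^ 2 ≤ pathEnergy N x + ε * ∑ s ∈ S, x s ^ 2 := by
  have : Nonempty (Fin N) := ⟨⟨0, hN⟩⟩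
  rw [le_lambdaMin_iff (isHermitian_perturbedLaplacian _ _ _)]
  have form (x : ℕ → ℝ) : (fun i : Fin N => x i) ⬝ᵥ
      (perturbedLaplacian (SimpleGraph.pathGraph N) S ε *ᵥ fun i : Fin N => x i) =
        pathEnergy N x + ε * ∑ s ∈ S, x s ^ 2 := by
    rw [perturbedLaplacian, add_mulVec, dotProduct_add, dotProduct_lapMatrix_pathGraph,
      smul_mulVec, dotProduct_smul, smul_eq_mul, sum_mulVec, dotProduct_sum]
    congr 2
    refine sum_congr rfl fun s _ => ?_
    rw [vecMulVec_mulVec]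
    simp [sq]
  have norm (x : ℕ → ℝ) : (fun i : Fin N => x i) ⬝ᵥ (fun i : Fin N => x i) =
      ∑ i ∈ range N, x i ^ 2 := by
    rw [← Fin.sum_univ_eq_sum_range (fun i => x i ^ 2) N]
    simp [dotProduct, sq]
  constructor
  · intro h x
    rw [← form, ← norm]
    exact h _
  · intro h x
    obtain ⟨y, rfl⟩ : ∃ y : ℕ → ℝ, (fun i : Fin N => y i) = x :=
      ⟨fun k => if hk : k < N then x ⟨k, hk⟩ else 0, by ext i; simp⟩
    rw [form, norm]
    exact h y

theorem pathEnergy_reflect (N : ℕ) (x : ℕ → ℝ) :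
    pathEnergy N (fun i => x (N - 1 - i)) = pathEnergy N x := by
  rw [pathEnergy, pathEnergy, ← Finset.sum_range_reflect (fun i => (x (i + 1) - x i) ^ 2)]
  refine Finset.sum_congr rfl fun i hi => ?_
  have hi := Finset.mem_range.1 hi
  rw [show N - 1 - 1 - i + 1 = N - 1 - i by omega, show N - 1 - (i + 1) = N - 1 - 1 - i by omega]
  ring

theorem sum_range_sq_reflect (N : ℕ) (x : ℕ → ℝ) :
    ∑ i ∈ Finset.range N, x (N - 1 - i) ^ 2 = ∑ i ∈ Finset.range N, x i ^ 2 :=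
  Finset.sum_range_reflect (fun i => x i ^ 2) N

/-- Splitting the path energy at the node `a`. -/
theorem pathEnergy_split (a b : ℕ) (x : ℕ → ℝ) :
    pathEnergy (a + b + 1) x =
      ∑ j ∈ Finset.range a, (x (a - (j + 1)) - x (a - j)) ^ 2 +
        ∑ j ∈ Finset.range b, (x (a + (j + 1)) - x (a + j)) ^ 2 := by
  rw [pathEnergy, Nat.add_sub_cancel, Finset.sum_range_add,
    ← Finset.sum_range_reflect (fun i => (x (i + 1) - x i) ^ 2)]
  congr 1
  refine Finset.sum_congr rfl fun i hi => ?_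
  have hi := Finset.mem_range.1 hi
  rw [show a - 1 - i + 1 = a - i by omega, show a - (i + 1) = a - 1 - i by omega]
  ring

theorem sum_range_split (a b : ℕ) (g : ℕ → ℝ) :
    ∑ i ∈ Finset.range (a + b + 1), g i =
      g a + ∑ j ∈ Finset.range a, g (a - (j + 1)) + ∑ j ∈ Finset.range b, g (a + (j + 1)) := by
  rw [add_assoc a b 1, Finset.sum_range_add, Finset.sum_range_succ', ← Finset.sum_range_reflect g]
  simp only [Nat.sub_sub, add_comm 1, add_zero]
  ring

/-! ### The arm profile and the lower bound for the central port. -/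

/-- The shape `U` of the lowest mode on an arm of length `m` behind a port, as a function of the
distance to the port, extended by a constant beyond the arm. Two such arms at a port of
strength `ε` form a mode with eigenvalue `μ`. -/
structure IsProfile (m : ℕ) (ε μ : ℝ) (U : ℕ → ℝ) : Prop where
  eig_pos : 0 < μ
  pos : ∀ j, 0 < U j
  lt_succ : ∀ j, j < m → U j < U (j + 1)
  const : ∀ j, m ≤ j → U j = U m
  recurrence : ∀ j, j < m → 2 * U (j + 1) - U j - U (j + 2) = μ * U (j + 1)
  port : 2 * (U 0 - U 1) + ε * U 0 = μ * U 0

namespace IsProfile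

variable {m : ℕ} {ε μ : ℝ} {U : ℕ → ℝ}

theorem monotone (h : IsProfile m ε μ U) : Monotone U := by
  refine monotone_nat_of_le_succ fun j => ?_
  rcases lt_or_ge j m with hj | hj
  · exact (h.lt_succ j hj).le
  · rw [h.const j hj, h.const (j + 1) (by omega)]

theorem le_top (h : IsProfile m ε μ U) (j : ℕ) : U j ≤ U m := by
  rcases le_total j m with hj | hj
  · exact h.monotone hj
  · exact (h.const j hj).le

/-- Lower bound for the energy of an arm, by completing squares. -/
theorem arm_lower (h : IsProfile m ε μ U) (y : ℕ → ℝ) {r : ℕ} (hr : r ≤ m) :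
    μ * ∑ j ∈ Finset.range r, y (j + 1) ^ 2 + (U (r + 1) - U r) / U r * y r ^ 2 -
      (U 1 - U 0) / U 0 * y 0 ^ 2 ≤ ∑ j ∈ Finset.range r, (y (j + 1) - y j) ^ 2 := by
  induction r with
  | zero => simp
  | succ r ih =>
    have ih := ih (by omega)
    rw [Finset.sum_range_succ, Finset.sum_range_succ]
    have h0 := h.pos r
    have h1 := h.pos (r + 1)
    have hrec := h.recurrence r (by omega)
    -- The recurrence as a Riccati step for the ratios `(U (r + 1) - U r) / U r`.
    have hc : (U (r + 1 + 1) - U (r + 1)) / U (r + 1) = (U (r + 1) - U r) / U (r + 1) - μ := by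
      rw [eq_sub_iff_add_eq, div_add' _ _ _ h1.ne', div_left_inj' h1.ne', ← hrec]
      ring_nf
    have hsq : 0 ≤ (y (r + 1) * U r - y r * U (r + 1)) ^ 2 / (U r * U (r + 1)) := by positivity
    have hid : (y (r + 1) * U r - y r * U (r + 1)) ^ 2 / (U r * U (r + 1)) =
        (y (r + 1) - y r) ^ 2 - (U (r + 1) - U r) / U (r + 1) * y (r + 1) ^ 2 +
          (U (r + 1) - U r) / U r * y r ^ 2 := by
      field_simp
      ring
    rw [hc]
    linarith

theorem le_form_center (h : IsProfile m ε μ U) (x : ℕ → ℝ) :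
    μ * ∑ i ∈ Finset.range (2 * m + 1), x i ^ 2 ≤
      pathEnergy (2 * m + 1) x + ε * x m ^ 2 := by
  have hl := h.arm_lower (fun j => x (m - j)) le_rfl
  have hr := h.arm_lower (fun j => x (m + j)) le_rfl
  rw [h.const (m + 1) (by omega), sub_self, zero_div] at hl hr
  have hp : ε = μ + 2 * ((U 1 - U 0) / U 0) := by
    have := (h.pos 0).ne'
    have := h.port
    field_simp
    linarith
  rw [two_mul, pathEnergy_split, sum_range_split]
  simp only [Nat.sub_zero, add_zero] at hl hr
  rw [hp]
  linarith

/-- Summation by parts; the boundary term at the far end vanishes since `U (m + 1) = U m`. -/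
theorem arm_energy (h : IsProfile m ε μ U) :
    ∑ j ∈ Finset.range m, (U (j + 1) - U j) ^ 2 =
      μ * ∑ j ∈ Finset.range m, U (j + 1) ^ 2 - U 0 * (U 1 - U 0) := by
  have key : ∀ r ≤ m, ∑ j ∈ Finset.range r, (U (j + 1) - U j) ^ 2 =
      μ * ∑ j ∈ Finset.range r, U (j + 1) ^ 2 - U 0 * (U 1 - U 0) +
        U r * (U (r + 1) - U r) := by
    intro r
    induction r with
    | zero => simp
    | succ r ih =>
      intro hr
      rw [Finset.sum_range_succ, Finset.sum_range_succ, ih (by omega)]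
      linear_combination U (r + 1) * h.recurrence r (by omega)
  rw [key m le_rfl, h.const (m + 1) (by omega)]
  ring

end IsProfile

/-! ### Upper bound for arbitrary port sets. -/

theorem sum_range_le_of_nonneg_of_eq_zero {f : ℕ → ℝ} {m : ℕ} (hf : ∀ j, 0 ≤ f j)
    (h0 : ∀ j, m ≤ j → f j = 0) (r : ℕ) :
    ∑ j ∈ Finset.range r, f j ≤ ∑ j ∈ Finset.range m, f j := by
  rcases le_total r m with hr | hr
  · exact Finset.sum_le_sum_of_subset_of_nonneg (Finset.range_mono hr) fun j _ _ => hf j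
  · refine (Finset.sum_subset (Finset.range_mono hr) fun j _ hj => h0 j ?_).ge
    simpa using hj

namespace IsProfile

variable {m : ℕ} {ε μ : ℝ} {U : ℕ → ℝ}

theorem energy_dist_le (h : IsProfile m ε μ U) {N s : ℕ} (hs : s < N) :
    pathEnergy N (fun i => U (Nat.dist s i)) ≤
      2 * ∑ j ∈ Finset.range m, (U (j + 1) - U j) ^ 2 := by
  obtain ⟨b, rfl⟩ : ∃ b, N = s + b + 1 := ⟨N - s - 1, by omega⟩
  have harm := sum_range_le_of_nonneg_of_eq_zero (f := fun j => (U (j + 1) - U j) ^ 2) (m := m)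
    (fun j => sq_nonneg _)
    (fun j hj => by simp only [h.const j hj, h.const (j + 1) (by omega)]; ring)
  rw [pathEnergy_split, two_mul]
  refine add_le_add (le_trans (le_of_eq ?_) (harm s)) (le_trans (le_of_eq ?_) (harm b))
  · refine Finset.sum_congr rfl fun j hj => ?_
    have hj := Finset.mem_range.1 hj
    rw [show Nat.dist s (s - (j + 1)) = j + 1 by unfold Nat.dist; omega,
      show Nat.dist s (s - j) = j by unfold Nat.dist; omega]
  · refine Finset.sum_congr rfl fun j hj => ?_
    rw [show Nat.dist s (s + (j + 1)) = j + 1 by unfold Nat.dist; omega,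
      show Nat.dist s (s + j) = j by unfold Nat.dist; omega]

/-- The deficit from the maximum `U m ^ 2` is nonnegative and vanishes beyond distance `m`, so an
arm of any length loses at most what an arm of length `m` does. -/
theorem deficit_dist_le (h : IsProfile m ε μ U) {N s : ℕ} (hs : s < N) :
    ∑ i ∈ Finset.range N, (U m ^ 2 - U (Nat.dist s i) ^ 2) ≤
      U m ^ 2 - U 0 ^ 2 + 2 * ∑ j ∈ Finset.range m, (U m ^ 2 - U (j + 1) ^ 2) := by
  obtain ⟨b, rfl⟩ : ∃ b, N = s + b + 1 := ⟨N - s - 1, by omega⟩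
  have harm := sum_range_le_of_nonneg_of_eq_zero (f := fun j => U m ^ 2 - U (j + 1) ^ 2) (m := m)
    (fun j => sub_nonneg.2 (pow_le_pow_left₀ (h.pos _).le (h.le_top _) 2))
    (fun j hj => by simp only [h.const (j + 1) (by omega)]; ring)
  rw [sum_range_split, two_mul, ← add_assoc]
  refine add_le_add (add_le_add (le_of_eq ?_) (le_trans (le_of_eq ?_) (harm s)))
    (le_trans (le_of_eq ?_) (harm b))
  · rw [Nat.dist_self]
  · refine Finset.sum_congr rfl fun j hj => ?_
    have hj := Finset.mem_range.1 hj
    rw [show Nat.dist s (s - (j + 1)) = j + 1 by unfold Nat.dist; omega]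
  · refine Finset.sum_congr rfl fun j hj => ?_
    rw [show Nat.dist s (s + (j + 1)) = j + 1 by unfold Nat.dist; omega]

end IsProfile

/-- At a minimizer `s` of the function with the smaller minimum, the gap between the minima is at
most the gap between the values at `s`. -/
theorem sq_sub_inf'_le {S : Finset ℕ} (hS : S.Nonempty) (f g : ℕ → ℝ) :
    (S.inf' hS f - S.inf' hS g) ^ 2 ≤ ∑ s ∈ S, (f s - g s) ^ 2 := by
  have key (f g : ℕ → ℝ) (hle : S.inf' hS g ≤ S.inf' hS f) :
      (S.inf' hS f - S.inf' hS g) ^ 2 ≤ ∑ s ∈ S, (f s - g s) ^ 2 := by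
    obtain ⟨s, hs, hg⟩ := S.exists_mem_eq_inf' hS g
    refine le_trans ?_ (Finset.single_le_sum (f := fun s => (f s - g s) ^ 2)
      (fun _ _ => sq_nonneg _) hs)
    have hf := S.inf'_le f hs
    exact pow_le_pow_left₀ (sub_nonneg.2 hle) (by linarith) 2
  rcases le_total (S.inf' hS g) (S.inf' hS f) with hle | hle
  · exact key f g hle
  · have := key g f hle
    rw [sub_sq_comm]
    simpa only [sub_sq_comm (g _) (f _)] using this

/-- The profile `U` applied to the distance to a nearest port in `S`. -/
noncomputable def portMode (U : ℕ → ℝ) (S : Finset ℕ) (hS : S.Nonempty) (i : ℕ) : ℝ :=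
  S.inf' hS fun s => U (Nat.dist s i)

namespace IsProfile

variable {m : ℕ} {ε μ : ℝ} {U : ℕ → ℝ}

theorem form_portMode_le (h : IsProfile m ε μ U) (hε : 0 ≤ ε) {N : ℕ} {S : Finset ℕ}
    (hS : S.Nonempty) (hSN : ∀ s ∈ S, s < N) (hN : N = S.card * (2 * m + 1)) :
    pathEnergy N (portMode U S hS) + ε * ∑ s ∈ S, portMode U S hS s ^ 2 ≤
      μ * ∑ i ∈ Finset.range N, portMode U S hS i ^ 2 := by
  have hpos (i : ℕ) : 0 < portMode U S hS i :=
    (Finset.lt_inf'_iff hS).2 fun s _ => h.pos _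
  have hE : pathEnergy N (portMode U S hS) ≤
      S.card * (2 * ∑ j ∈ Finset.range m, (U (j + 1) - U j) ^ 2) := by
    calc pathEnergy N (portMode U S hS)
        ≤ ∑ i ∈ Finset.range (N - 1),
            ∑ s ∈ S, (U (Nat.dist s (i + 1)) - U (Nat.dist s i)) ^ 2 :=
          Finset.sum_le_sum fun i _ => sq_sub_inf'_le hS _ _
      _ = ∑ s ∈ S, pathEnergy N (fun i => U (Nat.dist s i)) := Finset.sum_comm
      _ ≤ ∑ s ∈ S, 2 * ∑ j ∈ Finset.range m, (U (j + 1) - U j) ^ 2 :=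
          Finset.sum_le_sum fun s hs => h.energy_dist_le (hSN s hs)
      _ = _ := by rw [Finset.sum_const, nsmul_eq_mul]
  have hP : ∑ s ∈ S, portMode U S hS s ^ 2 ≤ S.card * U 0 ^ 2 := by
    rw [← nsmul_eq_mul, ← Finset.sum_const]
    refine Finset.sum_le_sum fun s hs => pow_le_pow_left₀ (hpos s).le ?_ 2
    have := S.inf'_le (fun t => U (Nat.dist t s)) hs
    rwa [Nat.dist_self] at this
  -- The deficit of a minimum is one of the individual deficits, hence at most their sum. As `N` is
  -- exactly `k * (2 * m + 1)`, the `U m ^ 2` terms later cancel.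
  have hD : ∑ i ∈ Finset.range N, (U m ^ 2 - portMode U S hS i ^ 2) ≤
      S.card * (U m ^ 2 - U 0 ^ 2 + 2 * ∑ j ∈ Finset.range m, (U m ^ 2 - U (j + 1) ^ 2)) := by
    calc ∑ i ∈ Finset.range N, (U m ^ 2 - portMode U S hS i ^ 2)
        ≤ ∑ i ∈ Finset.range N, ∑ s ∈ S, (U m ^ 2 - U (Nat.dist s i) ^ 2) := by
          refine Finset.sum_le_sum fun i _ => ?_
          obtain ⟨s, hs, hi⟩ := S.exists_mem_eq_inf' hS fun s => U (Nat.dist s i)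
          rw [portMode, hi]
          exact Finset.single_le_sum (f := fun s => U m ^ 2 - U (Nat.dist s i) ^ 2)
            (fun s _ => sub_nonneg.2 (pow_le_pow_left₀ (h.pos _).le (h.le_top _) 2)) hs
      _ = ∑ s ∈ S, ∑ i ∈ Finset.range N, (U m ^ 2 - U (Nat.dist s i) ^ 2) := Finset.sum_comm
      _ ≤ ∑ s ∈ S, (U m ^ 2 - U 0 ^ 2 +
            2 * ∑ j ∈ Finset.range m, (U m ^ 2 - U (j + 1) ^ 2)) :=
          Finset.sum_le_sum fun s hs => h.deficit_dist_le (hSN s hs)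
      _ = _ := by rw [Finset.sum_const, nsmul_eq_mul]
  rw [h.arm_energy] at hE
  simp only [Finset.sum_sub_distrib, Finset.sum_const, Finset.card_range, nsmul_eq_mul] at hD
  have hN' : (N : ℝ) = S.card * (2 * m + 1) := by rw [hN]; push_cast; ring
  have hnorm : S.card * (U 0 ^ 2 + 2 * ∑ j ∈ Finset.range m, U (j + 1) ^ 2) ≤
      ∑ i ∈ Finset.range N, portMode U S hS i ^ 2 := by
    rw [hN'] at hD
    linarith
  refine le_trans (add_le_add hE (mul_le_mul_of_nonneg_left hP hε))
    (le_trans (le_of_eq ?_) (mul_le_mul_of_nonneg_left hnorm h.eig_pos.le))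
  linear_combination (S.card * U 0) * h.port

end IsProfile

/-! ### The equality case: position of the extreme ports. -/

theorem eq_zero_of_forall_linear_add_sq_nonneg {B C : ℝ} (h : ∀ t : ℝ, 0 ≤ B * t + C * t ^ 2) :
    B = 0 := by
  have h1 := discrim_le_zero (a := C) (b := B) (c := 0) fun t => by linarith [h t, sq t]
  rw [discrim] at h1
  nlinarith [sq_nonneg B]

/-- The eigenvalue equation at the first node for a minimizer of the Rayleigh quotient. -/
theorem endpoint_equation {M : ℕ} {S : Finset ℕ} {ε μ : ℝ}
    (hform : ∀ x : ℕ → ℝ, μ * ∑ i ∈ Finset.range (M + 2), x i ^ 2 ≤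
      pathEnergy (M + 2) x + ε * ∑ s ∈ S, x s ^ 2)
    {w : ℕ → ℝ} (hw : pathEnergy (M + 2) w + ε * ∑ s ∈ S, w s ^ 2 ≤
      μ * ∑ i ∈ Finset.range (M + 2), w i ^ 2) :
    w 0 - w 1 + (if 0 ∈ S then ε else 0) * w 0 = μ * w 0 := by
  set e : ℝ := if 0 ∈ S then ε else 0 with he
  suffices 2 * (w 0 - w 1 + e * w 0 - μ * w 0) = 0 by linarith
  -- First variation: moving `w 0` by `t` changes the difference of the two sides by a quadratic in
  -- `t` with these coefficients.
  refine eq_zero_of_forall_linear_add_sq_nonneg (C := 1 + e - μ) fun t => ?_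
  have hf := hform (Function.update w 0 (w 0 + t))
  have hS : ε * ∑ s ∈ S, Function.update w 0 (w 0 + t) s ^ 2 =
      ε * ∑ s ∈ S, w s ^ 2 + e * (2 * w 0 * t + t ^ 2) := by
    have : ∀ s, Function.update w 0 (w 0 + t) s ^ 2 =
        w s ^ 2 + if 0 = s then 2 * w 0 * t + t ^ 2 else 0 := by
      rintro (- | s)
      · simp; ring
      · simp
    simp_rw [this, Finset.sum_add_distrib, Finset.sum_ite_eq, he]
    split_ifs <;> ring
  rw [hS] at hf
  simp only [pathEnergy, Nat.add_succ_sub_one, Finset.sum_range_succ' _ (M + 1),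
    Finset.sum_range_succ' _ M, Function.update_self, ne_eq, Nat.add_eq_zero_iff, one_ne_zero,
    and_false, not_false_eq_true, Function.update_of_ne, zero_add] at hf hw
  linarith

theorem form_reflect {N : ℕ} {S : Finset ℕ} (hSN : ∀ s ∈ S, s < N) {ε μ : ℝ}
    (hform : ∀ x : ℕ → ℝ, μ * ∑ i ∈ Finset.range N, x i ^ 2 ≤
      pathEnergy N x + ε * ∑ s ∈ S, x s ^ 2) (x : ℕ → ℝ) :
    μ * ∑ i ∈ Finset.range N, x i ^ 2 ≤
      pathEnergy N x + ε * ∑ s ∈ S.image (fun s => N - 1 - s), x s ^ 2 := by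
  have := hform fun i => x (N - 1 - i)
  rw [pathEnergy_reflect, sum_range_sq_reflect] at this
  rwa [Finset.sum_image]
  intro s hs t ht hst
  have := hSN s hs
  have := hSN t ht
  simp only at hst
  omega

namespace IsProfile

variable {m : ℕ} {ε μ : ℝ} {U : ℕ → ℝ}

/-- Let `p` be the first port. The endpoint equation fails for `p = 0 < m` by the port equation, for
`0 < p < m` because the recurrence would give `U p = U (p + 1)`, and for `p > m` because the mode is
flat at the end while `μ * U m > 0`. -/
theorem isLeast_of_form (h : IsProfile m ε μ U) (hε : 0 ≤ ε) {N : ℕ} {S : Finset ℕ}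
    (hS : S.Nonempty) (hSN : ∀ s ∈ S, s < N) (hN : N = S.card * (2 * m + 1))
    (hform : ∀ x : ℕ → ℝ, μ * ∑ i ∈ Finset.range N, x i ^ 2 ≤
      pathEnergy N x + ε * ∑ s ∈ S, x s ^ 2) : IsLeast (S : Set ℕ) m := by
  have hle := h.form_portMode_le hε hS hSN hN
  suffices S.min' hS = m from this ▸ S.isLeast_min' hS
  set p := S.min' hS with hp
  have hpS : p ∈ S := S.min'_mem hS
  have hpmin : ∀ s ∈ S, p ≤ s := fun s hs => S.min'_le s hs
  have hpN := hSN p hpS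
  -- The endpoint equation needs two nodes; `N = 1` forces `m = 0 = p`.
  obtain - | - | M := N
  · omega
  · have h1 := (mul_eq_one.1 hN.symm).2
    omega
  have heq := endpoint_equation hform hle
  have hw0 : portMode U S hS 0 = U p := by
    refine le_antisymm ?_ (Finset.le_inf' _ _ fun s hs => h.monotone ?_)
    · refine (S.inf'_le (fun s => U (Nat.dist s 0)) hpS).trans_eq ?_
      simp [Nat.dist]
    · simpa [Nat.dist] using hpmin s hs
  have hU0 := h.pos p
  rcases Nat.eq_zero_or_pos p with hp0 | hp0
  · by_contra hne
    rw [hw0, if_pos (hp0 ▸ hpS), hp0] at heq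
    have hw1 : portMode U S hS 1 ≤ U 1 := by
      refine (S.inf'_le (fun s => U (Nat.dist s 1)) hpS).trans_eq ?_
      simp [Nat.dist, hp0]
    have := h.lt_succ 0 (by omega)
    have := h.port
    simp only [zero_add] at *
    linarith
  · have hw1 : portMode U S hS 1 = U (p - 1) := by
      refine le_antisymm ?_ (Finset.le_inf' _ _ fun s hs => h.monotone ?_)
      · refine (S.inf'_le (fun s => U (Nat.dist s 1)) hpS).trans_eq ?_
        simp only [Nat.dist]
        congr 1
        omega
      · have := hpmin s hs
        simp only [Nat.dist]
        omega
    rw [hw0, hw1, if_neg fun h0 => absurd (hpmin 0 h0) (by omega), zero_mul, add_zero] at heq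
    rcases lt_trichotomy p m with hlt | heq' | hgt
    · have hrec := h.recurrence (p - 1) (by omega)
      rw [show p - 1 + 1 = p by omega, show p - 1 + 2 = p + 1 by omega] at hrec
      have := h.lt_succ p hlt
      linarith
    · exact heq'
    · rw [h.const p (by omega), h.const (p - 1) (by omega), sub_self] at heq
      exact absurd heq (mul_pos h.eig_pos (h.pos m)).ne

theorem isGreatest_of_form (h : IsProfile m ε μ U) (hε : 0 ≤ ε) {N : ℕ} {S : Finset ℕ}
    (hS : S.Nonempty) (hSN : ∀ s ∈ S, s < N) (hN : N = S.card * (2 * m + 1))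
    (hform : ∀ x : ℕ → ℝ, μ * ∑ i ∈ Finset.range N, x i ^ 2 ≤
      pathEnergy N x + ε * ∑ s ∈ S, x s ^ 2) : IsGreatest (S : Set ℕ) (N - 1 - m) := by
  have hinj : Set.InjOn (fun s => N - 1 - s) (S : Set ℕ) := by
    intro s hs t ht hst
    have := hSN s hs
    have := hSN t ht
    simp only at hst
    omega
  have hL := h.isLeast_of_form hε (hS.image fun s => N - 1 - s)
    (by
      simp only [Finset.mem_image, forall_exists_index, and_imp, forall_apply_eq_imp_iff₂]
      intro s hs
      have := hSN s hs
      omega)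
    (by rwa [Finset.card_image_of_injOn hinj]) (form_reflect hSN hform)
  obtain ⟨⟨s, hs, hsm⟩, hmin⟩ : (∃ s ∈ S, N - 1 - s = m) ∧ ∀ s ∈ S, m ≤ N - 1 - s := by
    simpa [IsLeast, mem_lowerBounds] using hL
  have hsN := hSN s hs
  refine ⟨by rwa [← hsm, Nat.sub_sub_self (by omega)], fun t ht => ?_⟩
  have := hmin t ht
  have := hSN t ht
  omega

end IsProfile

/-! ### Construction of the profile. -/

theorem exists_isProfile (m : ℕ) {ε : ℝ} (hε : 0 < ε) : ∃ μ U, IsProfile m ε μ U := by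
  rcases Nat.eq_zero_or_pos m with rfl | hm
  · exact ⟨ε, fun _ => 1, hε, fun _ => one_pos, by simp, by simp, by simp, by simp⟩
  have hm' : (1 : ℝ) ≤ m := by exact_mod_cast hm
  have hπ := Real.pi_pos
  set a : ℝ := m + 1 / 2 with ha
  have ha0 : 0 < a := by linarith
  -- With `U j = cos ((a - j) * θ)` and `μ = 2 - 2 * cos θ` only the port equation remains. Its left
  -- side minus its right side is `ε` at `θ = 0` and nonpositive at `θ = π / (2 * a)`.
  obtain ⟨θ, hθ, hg⟩ : ∃ θ ∈ Set.Icc 0 (Real.pi / 2 / a),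
      2 * (Real.cos (a * θ) - Real.cos ((a - 1) * θ)) + ε * Real.cos (a * θ) -
        (2 - 2 * Real.cos θ) * Real.cos (a * θ) = 0 := by
    refine intermediate_value_Icc' (f := fun θ => 2 * (Real.cos (a * θ) - Real.cos ((a - 1) * θ)) +
      ε * Real.cos (a * θ) - (2 - 2 * Real.cos θ) * Real.cos (a * θ)) (by positivity)
      (by fun_prop) ⟨?_, ?_⟩
    · have hc : 0 ≤ Real.cos ((a - 1) * (Real.pi / 2 / a)) := by
        apply Real.cos_nonneg_of_neg_pi_div_two_le_of_le
        · have : 0 ≤ (a - 1) * (Real.pi / 2 / a) := mul_nonneg (by linarith) (by positivity)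
          linarith
        · rw [← mul_div_assoc, div_le_iff₀ ha0]
          nlinarith
      simp only [mul_div_cancel₀ _ ha0.ne', Real.cos_pi_div_two]
      linarith
    · simp [hε.le]
  have hθ0 : 0 < θ := by
    refine lt_of_le_of_ne hθ.1 ?_
    rintro rfl
    simp [hε.ne'] at hg
  have hθ1 : a * θ < Real.pi / 2 := by
    refine lt_of_le_of_ne (by rw [mul_comm]; exact (le_div_iff₀ ha0).1 hθ.2) fun h => ?_
    rw [h, Real.cos_pi_div_two] at hg
    have : 0 < Real.cos ((a - 1) * θ) := by
      apply Real.cos_pos_of_mem_Ioo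
      have : 0 < (a - 1) * θ := mul_pos (by linarith) hθ0
      constructor <;> linarith
    linarith
  have hθπ : θ < Real.pi / 2 := by nlinarith
  set R : ℕ → ℝ := fun j => Real.cos ((a - j) * θ) with hR
  -- The half-integer `a` makes the cosine symmetric about `m + 1 / 2`, which is the free end
  -- condition.
  have hRm : R (m + 1) = R m := by
    simp only [hR, ha]
    rw [← Real.cos_neg]
    congr 1
    push_cast
    ring
  have hU (j : ℕ) (hj : j ≤ m + 1) : R (min j m) = R j := by
    rcases hj.lt_or_eq with hj | rfl
    · rw [min_eq_left (by omega)]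
    · rw [min_eq_right (by omega), hRm]
  refine ⟨2 - 2 * Real.cos θ, fun j => R (min j m), ?_, ?_, ?_, ?_, ?_, ?_⟩
  · have := Real.cos_lt_cos_of_nonneg_of_le_pi_div_two le_rfl hθπ.le hθ0
    rw [Real.cos_zero] at this
    linarith
  · intro j
    have hj : ((min j m : ℕ) : ℝ) ≤ m := by exact_mod_cast min_le_right j m
    have hj0 : (0 : ℝ) ≤ (min j m : ℕ) := Nat.cast_nonneg _
    apply Real.cos_pos_of_mem_Ioo
    constructor
    · have : 0 ≤ (a - (min j m : ℕ)) * θ := mul_nonneg (by linarith) hθ0.le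
      linarith
    · nlinarith
  · intro j hj
    have hj' : (j : ℝ) + 1 ≤ m := by exact_mod_cast hj
    have hj0 : (0 : ℝ) ≤ j := Nat.cast_nonneg _
    rw [hU j (by omega), hU (j + 1) (by omega)]
    apply Real.cos_lt_cos_of_nonneg_of_le_pi_div_two
    · push_cast
      exact mul_nonneg (by linarith) hθ0.le
    · nlinarith
    · push_cast
      nlinarith
  · intro j hj
    simp [hj]
  · intro j hj
    rw [hU j (by omega), hU (j + 1) (by omega), hU (j + 2) (by omega)]
    simp only [hR]
    push_cast
    rw [show (a - j) * θ = (a - (j + 1)) * θ + θ by ring,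
      show (a - (j + 2)) * θ = (a - (j + 1)) * θ - θ by ring, Real.cos_add, Real.cos_sub]
    ring
  · rw [hU 0 (by omega), hU 1 (by omega)]
    simp only [hR, Nat.cast_zero, sub_zero, Nat.cast_one]
    linarith

/-! ### Comparison of the two paths and uniqueness of the optimum. -/

theorem sum_image_val {N : ℕ} (S : Finset (Fin N)) (f : ℕ → ℝ) :
    ∑ s ∈ S.image Fin.val, f s = ∑ s ∈ S, f s :=
  Finset.sum_image fun _ _ _ _ h => Fin.ext h

theorem le_lambdaMin_center {m : ℕ} [DecidableRel (SimpleGraph.pathGraph (2 * m + 1)).Adj]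
    {ε μ : ℝ} {U : ℕ → ℝ} (h : IsProfile m ε μ U) {p : Fin (2 * m + 1)} (hp : (p : ℕ) = m) :
    μ ≤ lambdaMin (perturbedLaplacian (SimpleGraph.pathGraph (2 * m + 1)) {p} ε) := by
  rw [le_lambdaMin_pathGraph_iff (by omega)]
  intro x
  simpa [hp] using h.le_form_center x

/-- Two copies of the path on `n` nodes, joined at their ends, have the same smallest perturbed
eigenvalue when the port sits in the middle of each copy. -/
theorem lambdaMin_center_eq {n : ℕ} [DecidableRel (SimpleGraph.pathGraph n).Adj]
    [DecidableRel (SimpleGraph.pathGraph (2 * n)).Adj] {p : Fin n} {p₁ p₂ : Fin (2 * n)}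
    (hp : 2 * (p : ℕ) + 1 = n) (hp₁ : (p₁ : ℕ) = p) (hp₂ : (p₂ : ℕ) = n + p) (ε : ℝ) :
    lambdaMin (perturbedLaplacian (SimpleGraph.pathGraph n) {p} ε) =
      lambdaMin (perturbedLaplacian (SimpleGraph.pathGraph (2 * n)) {p₁, p₂} ε) := by
  have hn : 0 < n := by omega
  have hne : p₁ ≠ p₂ := fun h => by
    have := congrArg Fin.val h
    omega
  have hE (x : ℕ → ℝ) : pathEnergy (2 * n) x = pathEnergy n x +
      (x n - x (n - 1)) ^ 2 + pathEnergy n (fun i => x (n + i)) := by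
    rw [pathEnergy, pathEnergy, pathEnergy, show 2 * n - 1 = (n - 1 + 1) + (n - 1) by omega,
      Finset.sum_range_add, Finset.sum_range_succ, show n - 1 + 1 = n by omega]
    simp only [add_assoc]
  have hN (x : ℕ → ℝ) : ∑ i ∈ Finset.range (2 * n), x i ^ 2 =
      ∑ i ∈ Finset.range n, x i ^ 2 + ∑ i ∈ Finset.range n, x (n + i) ^ 2 := by
    rw [two_mul, Finset.sum_range_add]
  refine eq_of_forall_le_iff fun c => ?_
  rw [le_lambdaMin_pathGraph_iff hn, le_lambdaMin_pathGraph_iff (by omega)]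
  simp only [Finset.sum_singleton, Finset.sum_pair hne, hp₁, hp₂, hE, hN]
  constructor
  · intro h x
    have h1 := h x
    have h2 := h fun i => x (n + i)
    have := sq_nonneg (x n - x (n - 1))
    linarith
  · intro h x
    -- Even reflection across the middle edge: that edge costs no energy and both halves contribute
    -- equally.
    set y : ℕ → ℝ := fun i => if i < n then x i else x (n - 1 - (i - n)) with hy
    have hlow (i : ℕ) (hi : i < n) : y i = x i := if_pos hi
    have hhigh (i : ℕ) : y (n + i) = x (n - 1 - i) := by
      simp only [hy, if_neg (Nat.not_lt.2 (Nat.le_add_right n i)), Nat.add_sub_cancel_left]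
    have h1 := h y
    have hEy : pathEnergy n y = pathEnergy n x := by
      refine Finset.sum_congr rfl fun i hi => ?_
      have := Finset.mem_range.1 hi
      rw [hlow i (by omega), hlow (i + 1) (by omega)]
    have hNy : ∑ i ∈ Finset.range n, y i ^ 2 = ∑ i ∈ Finset.range n, x i ^ 2 :=
      Finset.sum_congr rfl fun i hi => by rw [hlow i (Finset.mem_range.1 hi)]
    have hmid : y n = y (n - 1) := by
      rw [hlow (n - 1) (by omega)]
      simpa using hhigh 0
    simp only [hhigh, pathEnergy_reflect, sum_range_sq_reflect] at h1
    rw [hEy, hNy, hmid, hlow p p.2, show n - 1 - (p : ℕ) = p by omega] at h1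
    linarith

/-- A set of `k` ports on the path of `k (2 m + 1)` nodes whose smallest perturbed eigenvalue is
at least that of the balanced configuration has its extreme ports at distance `m` from the ends. -/
theorem isLeast_isGreatest_of_le_lambdaMin {m N : ℕ}
    [DecidableRel (SimpleGraph.pathGraph N).Adj] {ε μ : ℝ} (hε : 0 ≤ ε) {U : ℕ → ℝ}
    (h : IsProfile m ε μ U) {S : Finset (Fin N)} (hS : S.Nonempty)
    (hN : N = S.card * (2 * m + 1))
    (hle : μ ≤ lambdaMin (perturbedLaplacian (SimpleGraph.pathGraph N) S ε)) :
    IsLeast (S.image Fin.val : Set ℕ) m ∧ IsGreatest (S.image Fin.val : Set ℕ) (N - 1 - m) := by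
  have hN0 : 0 < N := hN ▸ Nat.mul_pos hS.card_pos (Nat.succ_pos _)
  rw [le_lambdaMin_pathGraph_iff hN0] at hle
  have hlt : ∀ s ∈ S.image Fin.val, s < N := by simp
  have hcard : N = (S.image Fin.val).card * (2 * m + 1) := by
    rwa [Finset.card_image_of_injective _ Fin.val_injective]
  have hform : ∀ x : ℕ → ℝ, μ * ∑ i ∈ Finset.range N, x i ^ 2 ≤
      pathEnergy N x + ε * ∑ s ∈ S.image Fin.val, x s ^ 2 := fun x => by
    rw [sum_image_val S fun s => x s ^ 2]
    exact hle x
  exact ⟨h.isLeast_of_form hε (hS.image _) hlt hcard hform,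
    h.isGreatest_of_form hε (hS.image _) hlt hcard hform⟩

/-- A strictly better competitor would have to be `S₀` itself, so the rigidity hypothesis yields
optimality as well as uniqueness. -/
theorem isOptimalPorts_iff_eq {V : Type*} [Fintype V] [DecidableEq V] {G : SimpleGraph V}
    [DecidableRel G.Adj] {k : ℕ} {S₀ : Finset V} (hcard : S₀.card = k)
    (h : ∀ ε : ℝ, 0 < ε → ∀ T : Finset V, T.card = k →
      lambdaMin (perturbedLaplacian G S₀ ε) ≤ lambdaMin (perturbedLaplacian G T ε) → T = S₀)
    (S : Finset V) : IsOptimalPorts G k S ↔ S = S₀ := by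
  constructor
  · rintro ⟨hS, hev⟩
    obtain ⟨ε, hmax, hε⟩ := (hev.and self_mem_nhdsWithin).exists
    exact h ε hε S hS (hmax S₀ hcard)
  · rintro rfl
    refine ⟨hcard, ?_⟩
    filter_upwards [self_mem_nhdsWithin] with ε hε T hT
    by_contra! hlt
    rw [h ε hε T hT hlt.le] at hlt
    exact lt_irrefl _ hlt

theorem mainTheorem7 (n : ℕ) (hn : Odd n)
    [DecidableRel (SimpleGraph.pathGraph n).Adj]
    [DecidableRel (SimpleGraph.pathGraph (2 * n)).Adj] :
    (∀ S : Finset (Fin n),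
      IsOptimalPorts (SimpleGraph.pathGraph n) 1 S ↔ S = {pathCenter n hn}) ∧
    (∀ S : Finset (Fin (2 * n)),
      IsOptimalPorts (SimpleGraph.pathGraph (2 * n)) 2 S ↔
        S = {leftCenter n hn, rightCenter n hn}) ∧
    (∀ ε : ℝ,
      lambdaMin (perturbedLaplacian (SimpleGraph.pathGraph n) {pathCenter n hn} ε) =
        lambdaMin (perturbedLaplacian (SimpleGraph.pathGraph (2 * n))
          {leftCenter n hn, rightCenter n hn} ε)) := by
  have hc := pathCenter_spec n hn
  have hl := leftCenter_spec n hn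
  have hr := rightCenter_spec n hn
  have heq := lambdaMin_center_eq (p := pathCenter n hn) (p₁ := leftCenter n hn)
    (p₂ := rightCenter n hn) (by omega) (by omega) (by omega)
  have hne : leftCenter n hn ≠ rightCenter n hn := fun h => by
    have := congrArg Fin.val h
    omega
  obtain ⟨m, rfl⟩ := id hn
  refine ⟨isOptimalPorts_iff_eq (Finset.card_singleton _) ?_,
    isOptimalPorts_iff_eq (Finset.card_pair hne) ?_, heq⟩
  · intro ε hε T hT hle
    obtain ⟨μ, U, hU⟩ := exists_isProfile m hε
    obtain ⟨⟨hmem, -⟩, -⟩ := isLeast_isGreatest_of_le_lambdaMin hε.le hU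
      (Finset.card_pos.1 (by omega)) (by rw [hT, one_mul])
      ((le_lambdaMin_center hU (by omega)).trans hle)
    obtain ⟨t, rfl⟩ := Finset.card_eq_one.1 hT
    rw [Finset.singleton_inj, Fin.ext_iff]
    simp at hmem
    omega
  · intro ε hε T hT hle
    obtain ⟨μ, U, hU⟩ := exists_isProfile m hε
    obtain ⟨⟨hmem₁, -⟩, hmem₂, -⟩ := isLeast_isGreatest_of_le_lambdaMin hε.le hU
      (Finset.card_pos.1 (by omega)) (by rw [hT])
      ((le_lambdaMin_center hU (p := pathCenter _ hn) (by omega)).trans ((heq ε).trans_le hle))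
    obtain ⟨s, hs, hsm⟩ : ∃ s ∈ T, (s : ℕ) = m := by simpa using hmem₁
    obtain ⟨t, ht, htm⟩ : ∃ t ∈ T, (t : ℕ) = 2 * (2 * m + 1) - 1 - m := by simpa using hmem₂
    have hs' : s = leftCenter _ hn := Fin.ext (by omega)
    have ht' : t = rightCenter _ hn := Fin.ext (by omega)
    symm
    refine Finset.eq_of_subset_of_card_le ?_ (by rw [hT, Finset.card_pair hne])
    rw [Finset.insert_subset_iff, Finset.singleton_subset_iff]
    exact ⟨hs' ▸ hs, ht' ▸ ht⟩
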